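/- The game of Cops and Robbers with $k$ cops on a finite simple graph $G$ is played as follows. The cops first choose their starting vertices (several cops may share a vertex), then the robber chooses a starting vertex. In every later round first the cops move and then the robber moves; in a move each player either stays at the current vertex or goes to an adjacent one. All positions are visible to both sides. The cops win if after finitely many rounds some cop occupies the same vertex as the robber. The cop number $c(G)$ is the least number of cops having a winning strategy on $G$, and $G$ is called $k$-cop-win if $c(G)\le k$. A set $S$ of vertices is dominating if every vertex not in $S$ is adjacent to at least one member of $S$. Theorem. Fix $k\in\mathbb N$, and let $G(n,1/2)$ be the random graph on $n$ labelled vertices in which each pair of vertices is joined independently with probability $1/2$. As $n\to\infty$, $$\mathbb P\big(G(n,1/2)\text{ is } k\text{-cop-win}\big)=(1+o(1))\,(1-2^{-k})^{-k}\binom nk(1-2^{-k})^n=\Theta\big(n^k(1-2^{-k})^n\big).$$ Moreover the probability that $G(n,1/2)$ has a dominating set of cardinality $k$ has the same asymptotic value, $$\mathbb P\big(G(n,1/2)\text{ has a dominating set of cardinality } k\big)=(1+o(1))\,(1-2^{-k})^{-k}\binom nk(1-2^{-k})^n.$$ The implied constants and the rate of the $o(1)$ terms may depend on $k$. -/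

import Mathlib

open Filter Asymptotics

namespace CopsRobbers

variable {V : Type*}

/-- A strategy of `k` cops on `G`: it assigns to each history of robber positions (most recent
first) the positions of the cops. The value at `[]` is the initial placement, chosen before the
robber picks a starting vertex; afterwards every cop stays put or moves along an edge. -/
structure CopStrategy (G : SimpleGraph V) (k : ℕ) where
  /-- positions of the cops after they have seen the given robber positions -/
  pos : List V → Fin k → V
  legal : ∀ (h : List V) (r : V) (i : Fin k),
    pos (r :: h) i = pos h i ∨ G.Adj (pos h i) (pos (r :: h) i)

/-- `ρ t` is the position chosen by the robber in round `t`; the start `ρ 0` is arbitrary and in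
each later round the robber stays put or moves along an edge. -/
def IsRobberPlay (G : SimpleGraph V) (ρ : ℕ → V) : Prop :=
  ∀ t, ρ (t + 1) = ρ t ∨ G.Adj (ρ t) (ρ (t + 1))

/-- The robber positions `[ρ (t - 1), …, ρ 0]` before round `t`. -/
def history (ρ : ℕ → V) : ℕ → List V
  | 0 => []
  | t + 1 => ρ t :: history ρ t

/-- Some cop occupies the robber's vertex at some time: either directly after the robber has moved
to `ρ t`, or directly after the answer of the cops to that move. -/
def Captures {G : SimpleGraph V} {k : ℕ} (σ : CopStrategy G k) (ρ : ℕ → V) : Prop :=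
  ∃ t : ℕ, ∃ i : Fin k, σ.pos (history ρ t) i = ρ t ∨ σ.pos (history ρ (t + 1)) i = ρ t

/-- The strategy captures the robber in finite time, whatever the robber does. -/
def CopStrategy.IsWinning {G : SimpleGraph V} {k : ℕ} (σ : CopStrategy G k) : Prop :=
  ∀ ρ : ℕ → V, IsRobberPlay G ρ → Captures σ ρ

/-- `k` cops have a winning strategy on `G`. -/
def CopsCanWin (G : SimpleGraph V) (k : ℕ) : Prop :=
  ∃ σ : CopStrategy G k, σ.IsWinning

/-- On a finite graph, a cop on every vertex wins, so the infimum below is a minimum. -/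
theorem copsCanWin_card [Fintype V] (G : SimpleGraph V) : CopsCanWin G (Fintype.card V) :=
  ⟨⟨fun _ i => (Fintype.equivFin V).symm i, fun _ _ _ => Or.inl rfl⟩,
    fun ρ _ => ⟨0, Fintype.equivFin V (ρ 0), Or.inl (Equiv.symm_apply_apply _ _)⟩⟩

/-- The cop number `c(G)` of a finite graph: the least number of cops that can win. -/
noncomputable def copNumber [Fintype V] (G : SimpleGraph V) : ℕ :=
  sInf {k : ℕ | CopsCanWin G k}

/-- `G` is `k`-cop-win if `c(G) ≤ k`. -/
def IsCopWin [Fintype V] (G : SimpleGraph V) (k : ℕ) : Prop :=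
  copNumber G ≤ k

/-- Every vertex outside `S` is adjacent to some member of `S`. -/
def IsDominatingSet (G : SimpleGraph V) (S : Finset V) : Prop :=
  ∀ v, v ∉ S → ∃ u ∈ S, G.Adj u v

/-- `G` has a dominating set of cardinality exactly `k`. -/
def HasDominatingSet (G : SimpleGraph V) (k : ℕ) : Prop :=
  ∃ S : Finset V, S.card = k ∧ IsDominatingSet G S

/-- The edge probability `1/2`. -/
noncomputable def half : unitInterval :=
  ⟨1 / 2, by norm_num, by norm_num⟩

/-- The probability that the random graph `G(n, 1/2)` on the vertex set `Fin n` has property `A`. -/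
noncomputable def prob (n : ℕ) (A : SimpleGraph (Fin n) → Prop) : ℝ :=
  (SimpleGraph.binomialRandom (Fin n) half).real {G | A G}

/-- The function `(1 - 2^{-k})^{-k} (n choose k) (1 - 2^{-k})^n` of `n`. -/
noncomputable def mainTerm (k n : ℕ) : ℝ :=
  (1 - (2 : ℝ) ^ (-(k : ℤ))) ^ (-(k : ℤ)) * (n.choose k : ℝ) * (1 - (2 : ℝ) ^ (-(k : ℤ))) ^ n

end CopsRobbers

/-! For a fixed set `F`, the traces on `F` of the outside vertices are independent and uniform over
the subsets of `F`. A dominating `k`-set forbids the traces disjoint from it, a proportion `2 ^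
(-k)`. A graph is rich if on every bounded `F` less than `17/16 * 2 ^ (-k)` of the traces are
missing. Failure of richness has probability at most a polynomial times `(1 - 17/16 * 2 ^ (-k)) ^ n`
(`prob_not_isRich_le`), negligible against the main term even after multiplication by `n ^ k`.

In a rich graph two dominating `k`-sets would forbid too many traces
(`IsRich.dominatingSet_unique`), so the first-moment bound is sharp up to non-rich graphs. A
dominating `k`-set gives the cops a win at once; in a rich graph without one the robber escapes
(`exists_forall_isRich_not_copsCanWin`), so both probabilities agree asymptotically.

For the escape, a weak set `U` already uses up almost all the missing traces, so against any other
cop position the robber has every move he wants (`IsRich.exists_adj`), and a vertex undominated by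
`U` is his refuge when the cops stand on `U`. If no set is weak, collect vertices from which the
cops can force the robber back into the collection. A large collection would forbid too many traces
by the sunflower count `exists_card_separated_ge`; hence the collection stops growing early, and the
robber lives outside it. -/

namespace CopsRobbers

/-! ### The game: winning by domination, evading by invariants. -/

section Game

variable {V : Type*}

/-- If every vertex is dominated by the starting positions `s`, then the cops win at once. -/
theorem copsCanWin_of_dominating {G : SimpleGraph V} {k : ℕ} (s : Fin k → V)
    (hs : ∀ v, ∃ i, s i = v ∨ G.Adj (s i) v) : CopsCanWin G k := by
  classical
  let reply : V → Fin k → V := fun r i => if G.Adj (s i) r then r else s i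
  have hreply : ∀ r i, reply r i = s i ∨ G.Adj (s i) (reply r i) := by
    intro r i
    by_cases h : G.Adj (s i) r
    · right; simp [reply, h]
    · left; simp [reply, h]
  -- The last entry of a history is the robber's starting vertex: the cops answer it once and then
  -- stand still.
  let p : List V → Fin k → V := fun h i => (h.getLast?).elim (s i) (fun r => reply r i)
  refine ⟨⟨p, ?_⟩, ?_⟩
  · intro h r i
    cases h with
    | nil => simpa [p] using hreply r i
    | cons a l => left; simp [p, List.getLast?_cons_cons]
  · intro ρ _
    obtain ⟨i, hi⟩ := hs (ρ 0)
    refine ⟨0, i, ?_⟩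
    rcases hi with hi | hi
    · left; simpa [history, p] using hi
    · right; simp [history, p, reply, hi]

/-- The cops cannot win if the robber can maintain an invariant `I` relating the positions of the
cops and his own position, which keeps him out of reach of the cops. -/
theorem not_copsCanWin_of_invariant {G : SimpleGraph V} {k : ℕ} (I : (Fin k → V) → V → Prop)
    (start : ∀ c, ∃ z, I c z)
    (safe : ∀ c z, I c z → ∀ i, c i ≠ z ∧ ¬ G.Adj (c i) z)
    (step : ∀ c z c', I c z → (∀ i, c' i = c i ∨ G.Adj (c i) (c' i)) →
      ∃ z', (z' = z ∨ G.Adj z z') ∧ I c' z') : ¬ CopsCanWin G k := by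
  rintro ⟨σ, hσ⟩
  -- A state carries the history, from which `σ` recovers the cop positions, so the robber's play is
  -- a plain recursion.
  let State := {p : List V × V // I (σ.pos p.1) p.2}
  have hnext : ∀ p : State, ∃ q : State,
      q.1.1 = p.1.2 :: p.1.1 ∧ (q.1.2 = p.1.2 ∨ G.Adj p.1.2 q.1.2) := by
    rintro ⟨⟨h, z⟩, hp⟩
    obtain ⟨z', hz', hI⟩ := step _ _ (σ.pos (z :: h)) hp (fun i => σ.legal h z i)
    exact ⟨⟨⟨z :: h, z'⟩, hI⟩, rfl, hz'⟩
  choose next hnext₁ hnext₂ using hnext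
  obtain ⟨z₀, hz₀⟩ := start (σ.pos [])
  let st : ℕ → State := fun t => Nat.rec ⟨⟨[], z₀⟩, hz₀⟩ (fun _ p => next p) t
  let ρ : ℕ → V := fun t => (st t).1.2
  have hist : ∀ t, history ρ t = (st t).1.1 := by
    intro t
    induction t with
    | zero => rfl
    | succ t ih => rw [history, ih]; exact (hnext₁ (st t)).symm
  obtain ⟨t, i, h⟩ := hσ ρ fun t => hnext₂ (st t)
  have hs := safe _ _ (st t).2 i
  rw [history, hist t] at h
  rcases h with h | h
  · exact hs.1 h
  · rcases σ.legal (st t).1.1 (ρ t) i with h' | h'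
    · exact hs.1 (h'.symm.trans h)
    · rw [h] at h'; exact hs.2 h'

theorem CopsCanWin.mono [Nonempty V] {G : SimpleGraph V} {k l : ℕ} (hkl : k ≤ l)
    (h : CopsCanWin G k) : CopsCanWin G l := by
  obtain ⟨σ, hσ⟩ := h
  let v₀ : V := Classical.arbitrary V
  refine ⟨⟨fun h i => if hi : i.1 < k then σ.pos h ⟨i, hi⟩ else v₀, ?_⟩, ?_⟩
  · intro h r i
    by_cases hi : i.1 < k
    · simpa [hi] using σ.legal h r ⟨i, hi⟩
    · simp [hi]
  · intro ρ hρ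
    obtain ⟨t, i, h⟩ := hσ ρ hρ
    exact ⟨t, Fin.castLE hkl i, by simpa using h⟩

theorem isCopWin_iff_copsCanWin [Fintype V] [Nonempty V] (G : SimpleGraph V) (k : ℕ) :
    IsCopWin G k ↔ CopsCanWin G k := by
  refine ⟨fun h => ?_, fun h => Nat.sInf_le h⟩
  have hmem : copNumber G ∈ {k : ℕ | CopsCanWin G k} := Nat.sInf_mem ⟨_, copsCanWin_card G⟩
  exact CopsCanWin.mono h hmem

theorem HasDominatingSet.copsCanWin {G : SimpleGraph V} {k : ℕ} (h : HasDominatingSet G k) :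
    CopsCanWin G k := by
  obtain ⟨S, rfl, hS⟩ := h
  refine copsCanWin_of_dominating (fun i => (S.equivFin.symm i : V)) fun v => ?_
  by_cases hv : v ∈ S
  · exact ⟨S.equivFin ⟨v, hv⟩, by simp⟩
  · obtain ⟨u, hu, huv⟩ := hS v hv
    exact ⟨S.equivFin ⟨u, hu⟩, by simpa using Or.inr huv⟩

theorem not_copsCanWin_zero [Nonempty V] (G : SimpleGraph V) : ¬ CopsCanWin G 0 :=
  not_copsCanWin_of_invariant (fun _ _ => True) (fun _ => ⟨Classical.arbitrary V, trivial⟩)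
    (fun _ _ _ i => i.elim0) (fun _ z _ _ _ => ⟨z, Or.inl rfl, trivial⟩)

end Game

/-! ### Counting subsets separated by pairs `(v, U v)`. -/

section Counting

theorem two_pow_mul_card_box {V : Type*} [DecidableEq V] {F A B : Finset V} (hA : A ⊆ F)
    (hB : B ⊆ F) (hd : Disjoint A B) :
    2 ^ (A.card + B.card) * (F.powerset.filter fun S => B ⊆ S ∧ Disjoint A S).card
      = 2 ^ F.card := by
  have h : (F.powerset.filter fun S => B ⊆ S ∧ Disjoint A S) = Finset.Icc B (F \ A) := by
    ext S
    simp only [Finset.mem_filter, Finset.mem_powerset, Finset.mem_Icc,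
      Finset.subset_sdiff]
    rw [disjoint_comm (a := A)]
    tauto
  have hBA : B ⊆ F \ A := Finset.subset_sdiff.2 ⟨hB, hd.symm⟩
  rw [h, Finset.card_Icc_finset hBA, ← pow_add, Finset.card_sdiff_of_subset hA]
  congr 1
  have h1 := Finset.card_le_card hBA
  rw [Finset.card_sdiff_of_subset hA] at h1
  have h2 := Finset.card_le_card hA
  omega

/-- If the blocks `{v} ∪ U v` are disjoint then the events `v ∈ S, S ∩ U v = ∅` are independent. -/
theorem card_avoid_mul_le {V : Type*} [DecidableEq V] (k : ℕ) (U : V → Finset V)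
    (hU : ∀ v, (U v).card ≤ k) (T : Finset V) :
    ∀ F : Finset V, (∀ v ∈ T, insert v (U v) ⊆ F) → (∀ v ∈ T, v ∉ U v) →
      (∀ v ∈ T, ∀ w ∈ T, v ≠ w → Disjoint (insert v (U v)) (insert w (U w))) →
      (F.powerset.filter fun S => ∀ v ∈ T, ¬ (v ∈ S ∧ Disjoint (U v) S)).card
        * (2 ^ (k + 1)) ^ T.card ≤ 2 ^ F.card * (2 ^ (k + 1) - 1) ^ T.card := by
  induction T using Finset.induction_on with
  | empty => intro F _ _ _; simp
  | insert v T hv ih =>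
    intro F hF hvU hd
    set B := insert v (U v) with hB
    have hBF : B ⊆ F := hF v (Finset.mem_insert_self _ _)
    have hTB : ∀ w ∈ T, Disjoint (insert w (U w)) B := fun w hw =>
      hd w (Finset.mem_insert_of_mem hw) v (Finset.mem_insert_self _ _) (by
        rintro rfl; exact hv hw)
    have key := ih (F \ B)
      (fun w hw => Finset.subset_sdiff.2 ⟨hF w (Finset.mem_insert_of_mem hw), hTB w hw⟩)
      (fun w hw => hvU w (Finset.mem_insert_of_mem hw))
      (fun a ha b hb hab => hd a (Finset.mem_insert_of_mem ha) b (Finset.mem_insert_of_mem hb) hab)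
    have hcard : (F.powerset.filter fun S => ∀ w ∈ insert v T, ¬ (w ∈ S ∧ Disjoint (U w) S)).card
        ≤ (2 ^ B.card - 1) *
          ((F \ B).powerset.filter fun S => ∀ w ∈ T, ¬ (w ∈ S ∧ Disjoint (U w) S)).card := by
      -- The forbidden event at `v` says exactly `S ∩ B = {v}`; the part of `S` outside `B` is left
      -- to the induction.
      have hc : (B.powerset.erase {v}).card = 2 ^ B.card - 1 := by
        rw [Finset.card_erase_of_mem, Finset.card_powerset]
        simp [hB]
      rw [← hc, ← Finset.card_product]
      refine Finset.card_le_card_of_injOn (fun S => (S ∩ B, S \ B)) ?_ ?_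
      · intro S hS
        simp only [Finset.coe_filter, Finset.mem_powerset, Set.mem_ofPred_eq] at hS
        obtain ⟨hSF, hS⟩ := hS
        simp only [Finset.coe_product, Set.mem_prod, Finset.mem_coe, Finset.mem_erase,
          Finset.mem_powerset, Finset.mem_filter]
        refine ⟨⟨fun h => ?_, Finset.inter_subset_right⟩, Finset.sdiff_subset_sdiff hSF le_rfl, ?_⟩
        · have hvS : v ∈ S ∩ B := h ▸ Finset.mem_singleton_self v
          refine hS v (Finset.mem_insert_self _ _) ⟨(Finset.mem_inter.1 hvS).1, ?_⟩
          rw [Finset.disjoint_left]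
          intro x hx hxS
          have hxv : x ∈ S ∩ B := Finset.mem_inter.2 ⟨hxS, Finset.mem_insert_of_mem hx⟩
          rw [h, Finset.mem_singleton] at hxv
          exact hvU v (Finset.mem_insert_self _ _) (hxv ▸ hx)
        · rintro w hw ⟨h1, h2⟩
          refine hS w (Finset.mem_insert_of_mem hw) ⟨(Finset.mem_sdiff.1 h1).1, ?_⟩
          rw [Finset.disjoint_left] at h2 ⊢
          intro x hx hxS
          exact h2 hx (Finset.mem_sdiff.2 ⟨hxS,
            Finset.disjoint_left.1 (hTB w hw) (Finset.mem_insert_of_mem hx)⟩)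
      · intro S _ S' _ h
        simp only [Prod.mk.injEq] at h
        rw [← Finset.sdiff_union_inter S B, ← Finset.sdiff_union_inter S' B, h.1, h.2]
    have hBk : 2 ^ B.card ≤ 2 ^ (k + 1) := Nat.pow_le_pow_right (by norm_num)
      ((Finset.card_insert_le _ _).trans (by have := hU v; omega))
    have hBF' : 2 ^ F.card = 2 ^ B.card * 2 ^ (F \ B).card := by
      rw [← pow_add, Finset.card_sdiff_of_subset hBF]
      have := Finset.card_le_card hBF
      congr 1; omega
    rw [Finset.card_insert_of_notMem hv, pow_succ _ T.card, pow_succ _ T.card, hBF']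
    generalize ((F \ B).powerset.filter fun S => ∀ w ∈ T, ¬ (w ∈ S ∧ Disjoint (U w) S)).card = a
      at *
    have hb : 1 ≤ 2 ^ B.card := Nat.one_le_two_pow
    generalize 2 ^ B.card = b at *
    have hK : (b - 1) * 2 ^ (k + 1) ≤ b * (2 ^ (k + 1) - 1) := by
      rw [Nat.sub_mul, Nat.mul_sub]
      omega
    generalize 2 ^ (k + 1) = K at *
    calc _ ≤ (b - 1) * a * (K ^ T.card * K) := Nat.mul_le_mul_right _ hcard
      _ = (a * K ^ T.card) * ((b - 1) * K) := by ring
      _ ≤ (2 ^ (F \ B).card * (K - 1) ^ T.card) * (b * (K - 1)) := Nat.mul_le_mul key hK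
      _ = _ := by ring

/-- Avoiding `t` independent events then has proportion at most `15/32`, leaving the `17/32` needed
for sets `U v` of size at most one. -/
theorem exists_pow_mul_le (K : ℕ) (hK : 1 ≤ K) : ∃ t : ℕ, 32 * (K - 1) ^ t ≤ 15 * K ^ t := by
  have hK0 : (0 : ℝ) < K := by exact_mod_cast hK
  obtain ⟨t, ht⟩ := exists_pow_lt_of_lt_one (show (0 : ℝ) < 15 / 32 by norm_num)
    (show ((K : ℝ) - 1) / K < 1 by rw [div_lt_one hK0]; linarith)
  refine ⟨t, ?_⟩
  rw [div_pow, div_lt_iff₀ (by positivity)] at ht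
  have : (32 * (K - 1 : ℕ) ^ t : ℝ) ≤ 15 * K ^ t := by
    push_cast [hK]
    linarith
  exact_mod_cast this

/-- A sunflower argument: many pairs `(v, U v)` with few repetitions among the sets `U v` are
separated by substantially more sets `S` than a single set `U v` allows. -/
theorem exists_card_separated_ge (k : ℕ) : ∃ N : ℕ, ∀ (V : Type) [DecidableEq V]
    (U : V → Finset V) (T F : Finset V), N ≤ T.card → (∀ v ∈ T, insert v (U v) ⊆ F) →
    (∀ v ∈ T, v ∉ U v) → (∀ v, (U v).card ≤ k) →
    (∀ A, (T.filter fun v => U v = A).card ≤ 3) →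
    17 * 2 ^ F.card ≤
      16 * 2 ^ k * (F.powerset.filter fun S => ∃ v ∈ T, v ∈ S ∧ Disjoint (U v) S).card := by
  induction k with
  | zero =>
    -- All `U v` are empty, so the multiplicity bound contradicts `4 ≤ T.card`.
    refine ⟨4, fun V _ U T F hT _ _ hU hA => ?_⟩
    have h : (T.filter fun v => U v = ∅) = T :=
      Finset.filter_true_of_mem fun v _ => Finset.card_eq_zero.1 (Nat.le_zero.1 (hU v))
    have := hA ∅
    rw [h] at this
    omega
  | succ k ih =>
    obtain ⟨N, hN⟩ := ih
    obtain ⟨t, ht⟩ := exists_pow_mul_le (2 ^ (k + 1 + 1)) Nat.one_le_two_pow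
    -- At most `t` disjoint blocks cover at most `t * (k + 2)` points; were each of these in at most
    -- `N` of the `U v`, the size of `T` would not exceed `t * (k + 2) * (N + 1)`.
    refine ⟨t * (k + 2) * (N + 1) + 1, fun V _ U T F hT hF hv hU hA => ?_⟩
    let good : Finset V → Prop := fun R =>
      ∀ v ∈ R, ∀ w ∈ R, v ≠ w → Disjoint (insert v (U v)) (insert w (U w))
    by_cases hex : ∃ R ⊆ T, R.card = t ∧ good R
    · obtain ⟨R, hRT, hRt, hR⟩ := hex
      have h1 := card_avoid_mul_le (k + 1) U hU R F (fun v hv => hF v (hRT hv))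
        (fun w hw => hv w (hRT hw)) hR
      rw [hRt] at h1
      have h2 : (F.powerset.filter fun S => ∃ v ∈ T, v ∈ S ∧ Disjoint (U v) S).card +
          (F.powerset.filter fun S => ∀ v ∈ R, ¬ (v ∈ S ∧ Disjoint (U v) S)).card
            ≥ 2 ^ F.card := by
        rw [← Finset.card_powerset]
        refine le_trans (Finset.card_le_card ?_) (Finset.card_union_le _ _)
        intro S hS
        simp only [Finset.mem_union, Finset.mem_filter, hS, true_and]
        by_cases h : ∃ v ∈ R, v ∈ S ∧ Disjoint (U v) S
        · obtain ⟨v, hv, h⟩ := h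
          exact Or.inl ⟨v, hRT hv, h⟩
        · exact Or.inr fun v hv h' => h ⟨v, hv, h'⟩
      generalize (F.powerset.filter fun S => ∃ v ∈ T, v ∈ S ∧ Disjoint (U v) S).card = x at *
      generalize (F.powerset.filter fun S => ∀ v ∈ R, ¬ (v ∈ S ∧ Disjoint (U v) S)).card = a at *
      have h3 : 32 * a ≤ 15 * 2 ^ F.card := by
        have hpos : 0 < (2 ^ (k + 1 + 1)) ^ t := by positivity
        refine Nat.le_of_mul_le_mul_right ?_ hpos
        calc 32 * a * (2 ^ (k + 1 + 1)) ^ t = 32 * (a * (2 ^ (k + 1 + 1)) ^ t) := by ring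
          _ ≤ 32 * (2 ^ F.card * (2 ^ (k + 1 + 1) - 1) ^ t) := Nat.mul_le_mul_left _ h1
          _ = 2 ^ F.card * (32 * (2 ^ (k + 1 + 1) - 1) ^ t) := by ring
          _ ≤ 2 ^ F.card * (15 * (2 ^ (k + 1 + 1)) ^ t) := Nat.mul_le_mul_left _ ht
          _ = _ := by ring
      have h4 : 32 * x ≤ 16 * 2 ^ (k + 1) * x := by
        refine Nat.mul_le_mul_right _ ?_
        have : 1 ≤ 2 ^ k := Nat.one_le_two_pow
        rw [pow_succ]; omega
      omega
    · obtain ⟨R, hR, hmax⟩ := Finset.exists_max_image (T.powerset.filter good) Finset.card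
        ⟨∅, by simp [good]⟩
      simp only [Finset.mem_filter, Finset.mem_powerset] at hR hmax
      have hRt : R.card ≤ t := by
        by_contra hlt
        obtain ⟨R', hR', hc⟩ := Finset.exists_subset_card_eq (not_le.1 hlt).le
        exact hex ⟨R', hR'.trans hR.1, hc,
          fun v hv w hw => hR.2 v (hR' hv) w (hR' hw)⟩
      let W := R.biUnion fun v => insert v (U v)
      have hW : W.card ≤ t * (k + 2) := by
        refine (Finset.card_biUnion_le_card_mul _ _ (k + 2) fun v _ => ?_).trans
          (Nat.mul_le_mul_right _ hRt)
        exact (Finset.card_insert_le _ _).trans (by have := hU v; omega)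
      have hmeet : ∀ v ∈ T, v ∉ W → ∃ y ∈ W, y ∈ U v := by
        intro v hvT hvW
        by_contra hno
        push Not at hno
        have hdis : ∀ w ∈ R, Disjoint (insert v (U v)) (insert w (U w)) := by
          intro w hw
          rw [Finset.disjoint_right]
          intro y hy hyv
          have hyW : y ∈ W := Finset.mem_biUnion.2 ⟨w, hw, hy⟩
          rcases Finset.mem_insert.1 hyv with rfl | h
          · exact hvW hyW
          · exact hno y hyW h
        have hvR : v ∉ R := fun h =>
          hvW (Finset.mem_biUnion.2 ⟨v, h, Finset.mem_insert_self _ _⟩)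
        have := hmax (insert v R) ⟨Finset.insert_subset hvT hR.1, by
          intro a ha b hb hab
          rcases Finset.mem_insert.1 ha with rfl | ha' <;>
            rcases Finset.mem_insert.1 hb with rfl | hb'
          · exact absurd rfl hab
          · exact hdis b hb'
          · exact (hdis a ha').symm
          · exact hR.2 a ha' b hb' hab⟩
        rw [Finset.card_insert_of_notMem hvR] at this
        omega
      have hy : ∃ y ∈ W, N < (T.filter fun v => y ∈ U v).card := by
        by_contra hno
        push Not at hno
        have hsub : T ⊆ W ∪ W.biUnion fun y => T.filter fun v => y ∈ U v := by
          intro v hvT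
          by_cases hvW : v ∈ W
          · exact Finset.mem_union_left _ hvW
          · obtain ⟨y, hyW, hyv⟩ := hmeet v hvT hvW
            exact Finset.mem_union_right _
              (Finset.mem_biUnion.2 ⟨y, hyW, Finset.mem_filter.2 ⟨hvT, hyv⟩⟩)
        have h1 := (Finset.card_le_card hsub).trans (Finset.card_union_le _ _)
        have h2 := Finset.card_biUnion_le_card_mul W (fun y => T.filter fun v => y ∈ U v) N
          fun y hy => hno y hy
        have h3 : W.card * (N + 1) ≤ t * (k + 2) * (N + 1) := Nat.mul_le_mul_right _ hW
        rw [Nat.mul_succ] at h3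
        omega
      obtain ⟨y, -, hyN⟩ := hy
      -- Counting only sets that avoid the popular point `y` costs a factor `2`, and erasing `y`
      -- lowers the size of the `U v` by one. Erasure is injective on sets containing `y`, so
      -- multiplicities stay at most `3`; the value `∅` only keeps the size bound valid for all `v`.
      have main := hN V (fun v => if y ∈ U v then (U v).erase y else ∅)
        (T.filter fun v => y ∈ U v) (F.erase y) hyN.le ?_ ?_ ?_ ?_
      · by_cases hyF : y ∈ F
        · have hFc : F.card = (F.erase y).card + 1 := (Finset.card_erase_add_one hyF).symm
          have hle : ((F.erase y).powerset.filter fun S => ∃ v ∈ T.filter fun v => y ∈ U v,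
              v ∈ S ∧ Disjoint (if y ∈ U v then (U v).erase y else ∅) S).card ≤
              (F.powerset.filter fun S => ∃ v ∈ T, v ∈ S ∧ Disjoint (U v) S).card := by
            refine Finset.card_le_card fun S hS => ?_
            simp only [Finset.mem_filter, Finset.mem_powerset] at hS ⊢
            obtain ⟨hSF, v, ⟨hvT, hyv⟩, hvS, hdis⟩ := hS
            refine ⟨hSF.trans (Finset.erase_subset _ _), v, hvT, hvS, ?_⟩
            rw [if_pos hyv] at hdis
            rw [Finset.disjoint_left] at hdis ⊢
            intro z hz hzS
            refine hdis (Finset.mem_erase.2 ⟨?_, hz⟩) hzS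
            rintro rfl
            exact Finset.notMem_erase _ _ (hSF hzS)
          rw [hFc, pow_succ, pow_succ]
          have := Nat.mul_le_mul_left (16 * 2 ^ k) hle
          calc _ = 17 * 2 ^ (F.erase y).card * 2 := by ring
            _ ≤ _ := Nat.mul_le_mul_right 2 (main.trans this)
            _ = _ := by ring
        · obtain ⟨v, hv'⟩ := Finset.card_pos.1 (Nat.zero_lt_of_lt hyN)
          obtain ⟨hvT, hyv⟩ := Finset.mem_filter.1 hv'
          exact absurd (hF v hvT (Finset.mem_insert_of_mem hyv)) hyF
      · intro v hv'
        obtain ⟨hvT, hyv⟩ := Finset.mem_filter.1 hv'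
        rw [if_pos hyv]
        intro z hz
        rcases Finset.mem_insert.1 hz with rfl | hz
        · refine Finset.mem_erase.2 ⟨?_, hF _ hvT (Finset.mem_insert_self _ _)⟩
          rintro rfl
          exact hv _ hvT hyv
        · exact Finset.mem_erase.2 ⟨(Finset.mem_erase.1 hz).1,
            hF v hvT (Finset.mem_insert_of_mem (Finset.mem_erase.1 hz).2)⟩
      · intro v hv'
        obtain ⟨hvT, hyv⟩ := Finset.mem_filter.1 hv'
        rw [if_pos hyv]
        exact fun h => hv v hvT (Finset.mem_erase.1 h).2
      · intro v
        by_cases hyv : y ∈ U v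
        · rw [if_pos hyv, Finset.card_erase_of_mem hyv]
          have := hU v; omega
        · simp [hyv]
      · intro A
        refine le_trans (Finset.card_le_card ?_) (hA (insert y A))
        intro v hv'
        obtain ⟨hv', hvA⟩ := Finset.mem_filter.1 hv'
        obtain ⟨hvT, hyv⟩ := Finset.mem_filter.1 hv'
        rw [if_pos hyv] at hvA
        exact Finset.mem_filter.2 ⟨hvT, by rw [← hvA, Finset.insert_erase hyv]⟩

end Counting

/-! ### Rich graphs, weak sets and the robber's strategies. -/

section Rich

variable {V : Type*}

open Classical in
/-- The neighbours of `w` in `F`. -/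
noncomputable def trace (G : SimpleGraph V) (F : Finset V) (w : V) : Finset V :=
  F.filter fun v => G.Adj w v

theorem mem_trace {G : SimpleGraph V} {F : Finset V} {v w : V} :
    v ∈ trace G F w ↔ v ∈ F ∧ G.Adj w v := by
  simp [trace]

theorem trace_subset (G : SimpleGraph V) (F : Finset V) (w : V) : trace G F w ⊆ F :=
  fun _ h => (mem_trace.1 h).1

open Classical in
/-- The subsets of `F` that are not the trace of a vertex outside `F`. -/
noncomputable def missing (G : SimpleGraph V) (F : Finset V) : Finset (Finset V) :=
  F.powerset.filter fun S => ∀ w, w ∉ F → trace G F w ≠ S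

theorem mem_missing {G : SimpleGraph V} {F S : Finset V} :
    S ∈ missing G F ↔ S ⊆ F ∧ ∀ w, w ∉ F → trace G F w ≠ S := by
  simp only [missing, Finset.mem_filter, Finset.mem_powerset]

/-- On every set `F` of at most `f` vertices the proportion of missing traces is less than
`17 / 16 * 2 ^ (-k)`. -/
def IsRich (G : SimpleGraph V) (k f : ℕ) : Prop :=
  ∀ F : Finset V, F.card ≤ f → 16 * 2 ^ k * (missing G F).card < 17 * 2 ^ F.card

theorem IsRich.exists_trace_mem {G : SimpleGraph V} {k f : ℕ} (hG : IsRich G k f) {F : Finset V}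
    (hF : F.card ≤ f) {𝒮 : Finset (Finset V)} (h𝒮 : 𝒮 ⊆ F.powerset)
    (hcard : 17 * 2 ^ F.card ≤ 16 * 2 ^ k * 𝒮.card) : ∃ w, w ∉ F ∧ trace G F w ∈ 𝒮 := by
  by_contra hno
  push Not at hno
  have hsub : 𝒮 ⊆ missing G F := by
    intro S hS
    exact mem_missing.2 ⟨Finset.mem_powerset.1 (h𝒮 hS), fun w hw h => hno w hw (h ▸ hS)⟩
  exact absurd (hG F hF) (not_lt.2 (hcard.trans
    (Nat.mul_le_mul_left _ (Finset.card_le_card hsub))))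

/-- `v` is neither in `U` nor adjacent to a vertex of `U`. -/
def Undominated (G : SimpleGraph V) (U : Finset V) (v : V) : Prop :=
  ∀ u ∈ U, u ≠ v ∧ ¬ G.Adj u v

theorem Undominated.notMem {G : SimpleGraph V} {U : Finset V} {v : V} (h : Undominated G U v) :
    v ∉ U := fun hv => (h v hv).1 rfl

theorem undominated_of_trace {G : SimpleGraph V} {U F : Finset V} {w : V} (hUF : U ⊆ F)
    (hw : w ∉ F) (h : Disjoint U (trace G F w)) : Undominated G U w := by
  intro u hu
  refine ⟨?_, fun ha => ?_⟩
  · rintro rfl; exact hw (hUF hu)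
  · exact Finset.disjoint_left.1 h hu (mem_trace.2 ⟨hUF hu, ha.symm⟩)

/-- At least four vertices outside `U` have all but a bounded number of their neighbours
dominated by `U`. -/
def IsWeak (G : SimpleGraph V) (M : ℕ) (U : Finset V) : Prop :=
  ∃ T Q : Finset V, T.card ≤ M ∧ Q.card = 4 ∧ Disjoint Q U ∧
    ∀ v ∈ Q, ∀ w, G.Adj v w → Undominated G U w → w ∈ T

theorem HasDominatingSet.of_forall_not_undominated [Fintype V] {G : SimpleGraph V} {k : ℕ}
    {U : Finset V} (hU : U.card ≤ k) (hV : k ≤ Fintype.card V)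
    (h : ∀ v, ¬ Undominated G U v) : HasDominatingSet G k := by
  obtain ⟨S, hUS, hS⟩ := Finset.exists_superset_card_eq hU hV
  refine ⟨S, hS, fun v hv => ?_⟩
  have := h v
  simp only [Undominated] at this
  push Not at this
  obtain ⟨u, hu, huv⟩ := this
  exact ⟨u, hUS hu, huv fun h => hv (h ▸ hUS hu)⟩

variable [DecidableEq V]

/-- Of the sets avoiding `U`, one in `2 ^ 4` also misses `Q`. The four in `IsWeak` is chosen so that
the remaining `15/16` needs only `2/16` more to reach the threshold `17/16`. -/
theorem two_pow_mul_card_hitting {F U Q : Finset V} (hU : U ⊆ F) (hQ : Q ⊆ F)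
    (hd : Disjoint Q U) (hQc : Q.card = 4) :
    16 * 2 ^ U.card * (F.powerset.filter fun S => Disjoint U S ∧ ∃ v ∈ Q, v ∈ S).card
      = 15 * 2 ^ F.card := by
  have h1 := two_pow_mul_card_box hU (Finset.empty_subset F) (Finset.disjoint_empty_right U)
  have h2 := two_pow_mul_card_box (Finset.union_subset hU hQ) (Finset.empty_subset F)
    (Finset.disjoint_empty_right (U ∪ Q))
  have h3 : (F.powerset.filter fun S => Disjoint U S ∧ ∃ v ∈ Q, v ∈ S).card +
      (F.powerset.filter fun S => ∅ ⊆ S ∧ Disjoint (U ∪ Q) S).card =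
      (F.powerset.filter fun S => ∅ ⊆ S ∧ Disjoint U S).card := by
    rw [← Finset.card_union_of_disjoint]
    · congr 1
      ext S
      simp only [Finset.mem_union, Finset.mem_filter, Finset.empty_subset, true_and,
        Finset.disjoint_union_left, ← and_or_left]
      by_cases h : ∃ v ∈ Q, v ∈ S
      · simp [h]
      · have : Disjoint Q S := Finset.disjoint_left.2 fun v hv hS => h ⟨v, hv, hS⟩
        simp [this]
    · rw [Finset.disjoint_left]
      intro S hS hS'
      simp only [Finset.mem_filter, Finset.disjoint_union_left] at hS hS'
      obtain ⟨-, -, v, hv, hvS⟩ := hS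
      exact Finset.disjoint_left.1 hS'.2.2.2 hv hvS
  rw [Finset.card_union_of_disjoint hd.symm, hQc] at h2
  rw [← h3] at h1
  simp only [Finset.card_empty, add_zero, pow_add] at h1 h2
  rw [mul_add] at h1
  generalize Finset.card (F.powerset.filter fun S => ∅ ⊆ S ∧ Disjoint (U ∪ Q) S) = y at h1 h2
  linarith

/-- In a rich graph, for `U` weak and `U' ≠ U` there are vertices undominated by `U'` that are
adjacent to one or two prescribed vertices. -/
theorem IsRich.exists_adj {G : SimpleGraph V} {k f M : ℕ} (hG : IsRich G k f)
    (hf : M + 2 * k + 6 ≤ f) {U : Finset V} (hU : U.card ≤ k) (hw : IsWeak G M U)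
    {U' : Finset V} (hU' : U'.card ≤ k) (hne : U' ≠ U) {B : Finset V} (hB : B.card ≤ 2)
    (hd : Disjoint U' B) : ∃ w, Undominated G U' w ∧ ∀ b ∈ B, G.Adj b w := by
  obtain ⟨T, Q, hT, hQ, hQU, hTQ⟩ := hw
  set F := U ∪ (T ∪ (Q ∪ (U' ∪ B))) with hFdef
  have hUF : U ⊆ F := Finset.subset_union_left
  have hTF : T ⊆ F := by intro x hx; simp [hFdef, hx]
  have hQF : Q ⊆ F := by intro x hx; simp [hFdef, hx]
  have hU'F : U' ⊆ F := by intro x hx; simp [hFdef, hx]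
  have hBF : B ⊆ F := by intro x hx; simp [hFdef, hx]
  have hF : F.card ≤ f := by
    have h1 := Finset.card_union_le U (T ∪ (Q ∪ (U' ∪ B)))
    have h2 := Finset.card_union_le T (Q ∪ (U' ∪ B))
    have h3 := Finset.card_union_le Q (U' ∪ B)
    have h4 := Finset.card_union_le U' B
    rw [hFdef]
    omega
  set 𝒮₁ := F.powerset.filter fun S => Disjoint U S ∧ ∃ v ∈ Q, v ∈ S with h𝒮₁
  have hcard₁ : 16 * 2 ^ U.card * 𝒮₁.card = 15 * 2 ^ F.card :=
    two_pow_mul_card_hitting hUF hQF hQU hQ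
  have hnot : ∀ w, w ∉ F → trace G F w ∉ 𝒮₁ := by
    intro w hwF h
    obtain ⟨-, h1, v, hv, hvw⟩ := Finset.mem_filter.1 h
    exact hwF (hTF (hTQ v hv w (mem_trace.1 hvw).2.symm (undominated_of_trace hUF hwF h1)))
  rcases hU.lt_or_eq with hlt | hUk
  -- A smaller weak set would make at least `30/16 * 2 ^ (-k)` of the traces missing, which richness
  -- excludes.
  · have : 2 * 2 ^ U.card ≤ 2 ^ k := by
      rw [← pow_succ']; exact Nat.pow_le_pow_right (by norm_num) hlt
    obtain ⟨w, hwF, hw⟩ := hG.exists_trace_mem hF (𝒮 := 𝒮₁) (Finset.filter_subset _ _) (by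
      calc 17 * 2 ^ F.card ≤ 2 * (15 * 2 ^ F.card) := by omega
        _ = 16 * (2 * 2 ^ U.card) * 𝒮₁.card := by rw [← hcard₁]; ring
        _ ≤ _ := Nat.mul_le_mul_right _ (Nat.mul_le_mul_left _ this))
    exact absurd hw (hnot w hwF)
  · obtain ⟨u, hu, huU'⟩ : ∃ u ∈ U, u ∉ U' := by
      by_contra hno
      push Not at hno
      exact hne (Finset.eq_of_subset_of_card_le hno (by omega)).symm
    -- Requiring `u` makes this family disjoint from `𝒮₁`. At most `k` excluded and three required
    -- points give at least `2/16 * 2 ^ (-k)`; with `𝒮₁` this reaches `17/16 * 2 ^ (-k)`, so a trace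
    -- occurs in the union, and it cannot be in `𝒮₁`.
    set 𝒮₂ := F.powerset.filter fun S => insert u B ⊆ S ∧ Disjoint U' S with h𝒮₂
    have hcard₂ : 2 * 2 ^ F.card ≤ 16 * 2 ^ k * 𝒮₂.card := by
      have h := two_pow_mul_card_box hU'F (Finset.insert_subset (hUF hu) hBF)
        (Finset.disjoint_insert_right.2 ⟨huU', hd⟩)
      have hle : 2 ^ (U'.card + (insert u B).card) ≤ 2 ^ (k + 3) :=
        Nat.pow_le_pow_right (by norm_num)
          (by have := Finset.card_insert_le u B; omega)
      rw [← h]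
      calc _ ≤ 2 * (2 ^ (k + 3) * 𝒮₂.card) :=
            Nat.mul_le_mul_left _ (Nat.mul_le_mul_right _ hle)
        _ = _ := by ring
    have hdisj : Disjoint 𝒮₁ 𝒮₂ := by
      rw [Finset.disjoint_left]
      intro S h1 h2
      exact Finset.disjoint_left.1 (Finset.mem_filter.1 h1).2.1 hu
        ((Finset.mem_filter.1 h2).2.1 (Finset.mem_insert_self _ _))
    obtain ⟨w, hwF, hw⟩ := hG.exists_trace_mem hF (𝒮 := 𝒮₁ ∪ 𝒮₂)
      (Finset.union_subset (Finset.filter_subset _ _) (Finset.filter_subset _ _)) (by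
        rw [Finset.card_union_of_disjoint hdisj, mul_add]
        rw [hUk] at hcard₁
        omega)
    have hw₂ := (Finset.mem_union.1 hw).resolve_left (hnot w hwF)
    obtain ⟨-, h1, h2⟩ := Finset.mem_filter.1 hw₂
    exact ⟨w, undominated_of_trace hU'F hwF h2, fun b hb =>
      (mem_trace.1 (h1 (Finset.mem_insert_of_mem hb))).2.symm⟩

/-- The condition on neighbours is automatic, so any four vertices outside `U` serve. In particular
dominating sets are weak, with `T = ∅`. -/
theorem isWeak_of_undominated_subset [Fintype V] {G : SimpleGraph V} {M : ℕ} {U T : Finset V}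
    (hV : U.card + 4 ≤ Fintype.card V) (hT : T.card ≤ M)
    (h : ∀ w, Undominated G U w → w ∈ T) : IsWeak G M U := by
  obtain ⟨Q, hQ, hQc⟩ := Finset.exists_subset_card_eq
    (show 4 ≤ (Uᶜ).card by rw [Finset.card_compl]; omega)
  exact ⟨T, Q, hT, hQc, Finset.disjoint_left.2 fun x hx => Finset.mem_compl.1 (hQ hx),
    fun _ _ w _ hw => h w hw⟩

/-- A rich graph has at most one dominating set of cardinality `k`. -/
theorem IsRich.dominatingSet_unique [Fintype V] {G : SimpleGraph V} {k f M : ℕ}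
    (hG : IsRich G k f) (hf : M + 2 * k + 6 ≤ f) (hV : k + 4 ≤ Fintype.card V) {U U' : Finset V}
    (hU : U.card = k) (hU' : U'.card = k) (hdU : IsDominatingSet G U)
    (hdU' : IsDominatingSet G U') : U' = U := by
  have hno : ∀ {U : Finset V}, IsDominatingSet G U → ∀ w, ¬ Undominated G U w := by
    intro U hU w hw
    obtain ⟨u, hu, huw⟩ := hU w hw.notMem
    exact (hw u hu).2 huw
  by_contra hne
  obtain ⟨w, hw, -⟩ := hG.exists_adj hf hU.le
    (isWeak_of_undominated_subset (T := ∅) (by omega) (by simp) fun w hw =>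
      absurd hw (hno hdU w)) hU'.le hne (B := ∅) (by simp) (by simp)
  exact hno hdU' w hw

theorem safe_of_undominated {G : SimpleGraph V} {k : ℕ} {c : Fin k → V} {z : V}
    (h : Undominated G (Finset.univ.image c) z) (i : Fin k) : c i ≠ z ∧ ¬ G.Adj (c i) z :=
  h (c i) (Finset.mem_image_of_mem c (Finset.mem_univ i))

theorem notMem_image_of_legal {G : SimpleGraph V} {k : ℕ} {c c' : Fin k → V} {z : V}
    (h : Undominated G (Finset.univ.image c) z)
    (hc : ∀ i, c' i = c i ∨ G.Adj (c i) (c' i)) : z ∉ Finset.univ.image c' := by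
  intro hz
  obtain ⟨i, -, hi⟩ := Finset.mem_image.1 hz
  have hs := safe_of_undominated h i
  rcases hc i with h' | h'
  · exact hs.1 (h'.symm.trans hi)
  · exact hs.2 (hi ▸ h')

/-- If `a` is undominated by a weak set `U`, the robber evades the cops by staying close to `a`. -/
theorem IsRich.not_copsCanWin_of_isWeak {G : SimpleGraph V} {k f M : ℕ} (hG : IsRich G k f)
    (hf : M + 2 * k + 6 ≤ f) {U : Finset V} (hU : U.card ≤ k) (hw : IsWeak G M U) {a : V}
    (ha : Undominated G U a) : ¬ CopsCanWin G k := by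
  have hcard : ∀ c : Fin k → V, (Finset.univ.image c).card ≤ k := fun c =>
    Finset.card_image_le.trans (by simp)
  -- The second clause guarantees a retreat to `a` whenever the cops move onto `U`.
  refine not_copsCanWin_of_invariant (fun c z => Undominated G (Finset.univ.image c) z ∧
    (a ∈ Finset.univ.image c ∨ z = a ∨ G.Adj z a)) ?_ (fun c z h => safe_of_undominated h.1) ?_
  · intro c
    by_cases hc : Finset.univ.image c = U
    · exact ⟨a, hc ▸ ha, Or.inr (Or.inl rfl)⟩
    · by_cases hac : a ∈ Finset.univ.image c
      · obtain ⟨w, hw, -⟩ := hG.exists_adj hf hU hw (hcard c) hc (B := ∅) (by simp) (by simp)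
        exact ⟨w, hw, Or.inl hac⟩
      · obtain ⟨w, hw, hwa⟩ := hG.exists_adj hf hU hw (hcard c) hc (B := {a}) (by simp)
          (by simpa using hac)
        exact ⟨w, hw, Or.inr (Or.inr (hwa a (by simp)).symm)⟩
  · rintro c z c' ⟨hz, hza⟩ hcc'
    have hzc' := notMem_image_of_legal hz hcc'
    by_cases hc : Finset.univ.image c' = U
    · refine ⟨a, ?_, hc ▸ ha, Or.inr (Or.inl rfl)⟩
      rcases hza with hac | rfl | h
      -- A cop standing on `a` cannot have moved into `U`, which does not dominate `a`.
      · exfalso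
        obtain ⟨i, -, hi⟩ := Finset.mem_image.1 hac
        have hmem : c' i ∈ U := hc ▸ Finset.mem_image_of_mem c' (Finset.mem_univ i)
        have := ha _ hmem
        rcases hcc' i with h | h
        · exact this.1 (h.trans hi)
        · exact this.2 (hi ▸ h.symm)
      · exact Or.inl rfl
      · exact Or.inr h
    · by_cases hac : a ∈ Finset.univ.image c'
      · obtain ⟨w, hw, hwz⟩ := hG.exists_adj hf hU hw (hcard c') hc (B := {z}) (by simp)
          (Finset.disjoint_singleton_right.2 hzc')
        exact ⟨w, Or.inr (hwz z (by simp)), hw, Or.inl hac⟩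
      · obtain ⟨w, hw, hwz⟩ := hG.exists_adj hf hU hw (hcard c') hc (B := {z, a})
          Finset.card_le_two
          (Finset.disjoint_insert_right.2 ⟨hzc', Finset.disjoint_singleton_right.2 hac⟩)
        exact ⟨w, Or.inr (hwz z (by simp)), hw, Or.inr (Or.inr (hwz a (by simp)).symm)⟩

/-- The robber evades the cops outside of `T` if `T` cannot be extended by a vertex whose
neighbours are dominated by the cops, up to elements of `T`. -/
theorem not_copsCanWin_of_closed {G : SimpleGraph V} {k : ℕ} (T : Finset V)
    (hstart : ∀ U : Finset V, U.card ≤ k → ∃ w, w ∉ T ∧ Undominated G U w)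
    (hstep : ∀ v, v ∉ T → ∀ U : Finset V, U.card ≤ k → v ∉ U →
      ∃ w, w ∉ T ∧ Undominated G U w ∧ G.Adj v w) : ¬ CopsCanWin G k := by
  have hcard : ∀ c : Fin k → V, (Finset.univ.image c).card ≤ k := fun c =>
    Finset.card_image_le.trans (by simp)
  refine not_copsCanWin_of_invariant (fun c z => z ∉ T ∧ Undominated G (Finset.univ.image c) z)
    (fun c => hstart _ (hcard c)) (fun c z h => safe_of_undominated h.2) ?_
  rintro c z c' ⟨hzT, hz⟩ hcc'
  obtain ⟨w, hwT, hw, hzw⟩ := hstep z hzT _ (hcard c') (notMem_image_of_legal hz hcc')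
  exact ⟨w, Or.inr hzw, hwT, hw⟩

end Rich

/-! ### Evasion in rich graphs without a dominating `k`-set. -/

/-- Rich graphs of bounded richness and sufficiently large order that have no dominating set of
cardinality `k` are not `k`-cop-win. -/
theorem exists_forall_isRich_not_copsCanWin (k : ℕ) : ∃ f : ℕ, 2 * k + 6 ≤ f ∧
    ∀ (V : Type) [Fintype V] (G : SimpleGraph V), k + 4 ≤ Fintype.card V → IsRich G k f →
      ¬ HasDominatingSet G k → ¬ CopsCanWin G k := by
  classical
  obtain ⟨M, hM⟩ := exists_card_separated_ge k
  -- `M * (k + 1)` bounds the union of `M` blocks `insert v (U v)`; the rest is the demand of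
  -- `IsRich.exists_adj`.
  refine ⟨M * (k + 1) + M + 2 * k + 6, by omega, fun V _ G hV hG hdom => ?_⟩
  by_cases hweak : ∃ U : Finset V, U.card ≤ k ∧ IsWeak G M U
  · obtain ⟨U, hU, hw⟩ := hweak
    obtain ⟨a, ha⟩ : ∃ a, Undominated G U a := by
      by_contra hno
      push Not at hno
      exact hdom (HasDominatingSet.of_forall_not_undominated hU (by omega) hno)
    exact hG.not_copsCanWin_of_isWeak (M := M) (by omega) hU hw ha
  push Not at hweak
  -- From `v ∈ T`, cops on `U v` leave the robber no safe move out of `T`. If `T` is maximal and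
  -- smaller than `M`, no further vertex has this property, so he can stay outside.
  let good : Finset V → Prop := fun T => T.card ≤ M ∧ ∃ U : V → Finset V, ∀ v,
    (U v).card ≤ k ∧ v ∉ U v ∧ (v ∈ T → ∀ w, G.Adj v w → Undominated G (U v) w → w ∈ T)
  obtain ⟨T, hT, hmax⟩ := Finset.exists_max_image (Finset.univ.filter good) Finset.card
    ⟨∅, by simp only [Finset.mem_filter_univ]; exact ⟨by simp, fun _ => ∅, by simp⟩⟩
  simp only [Finset.mem_filter_univ] at hT hmax
  obtain ⟨hTM, U, hU⟩ := hT
  rcases hTM.lt_or_eq with hlt | heq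
  · refine not_copsCanWin_of_closed T (fun A hA => ?_) (fun v hv A hA hvA => ?_)
    · by_contra hno
      push Not at hno
      exact hweak A hA (isWeak_of_undominated_subset (by omega) hTM fun w hw => by
        by_contra h; exact hno w h hw)
    · by_contra hno
      push Not at hno
      have := hmax (insert v T) ⟨(Finset.card_insert_le _ _).trans hlt,
        fun x => if x = v then A else U x, fun x => ?_⟩
      · rw [Finset.card_insert_of_notMem hv] at this
        omega
      · by_cases hx : x = v
        · subst hx
          simp only [if_true]
          refine ⟨hA, hvA, fun _ w hxw hw => Finset.mem_insert_of_mem ?_⟩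
          by_contra h
          exact hno w h hw hxw
        · simp only [if_neg hx]
          exact ⟨(hU x).1, (hU x).2.1, fun hxT w hxw hw => Finset.mem_insert_of_mem
            ((hU x).2.2 (Finset.mem_of_mem_insert_of_ne hxT hx) w hxw hw)⟩
  · exfalso
    set F := T.biUnion fun v => insert v (U v) with hF
    have hFT : ∀ v ∈ T, insert v (U v) ⊆ F := fun v hv =>
      Finset.subset_biUnion_of_mem (fun v => insert v (U v)) hv
    have hFc : F.card ≤ M * (k + 1) := by
      rw [← heq]
      refine Finset.card_biUnion_le_card_mul _ _ (k + 1) fun v _ => ?_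
      exact (Finset.card_insert_le _ _).trans (by have := (hU v).1; omega)
    -- Four vertices of `T` sharing `A` would make `A` weak.
    have hrep : ∀ A, (T.filter fun v => U v = A).card ≤ 3 := by
      intro A
      by_contra hlt
      obtain ⟨Q, hQ, hQc⟩ := Finset.exists_subset_card_eq (show 4 ≤ (T.filter fun v => U v = A).card by omega)
      have hQ' : ∀ v ∈ Q, v ∈ T ∧ U v = A := fun v hv => Finset.mem_filter.1 (hQ hv)
      obtain ⟨q, hq⟩ := Finset.card_pos.1 (show 0 < Q.card by omega)
      refine hweak A ((hQ' q hq).2 ▸ (hU q).1) ⟨T, Q, hTM, hQc, ?_, fun v hv w hvw hw => ?_⟩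
      · rw [Finset.disjoint_left]
        intro v hv
        exact (hQ' v hv).2 ▸ (hU v).2.1
      · exact (hU v).2.2 (hQ' v hv).1 w hvw ((hQ' v hv).2.symm ▸ hw)
    -- Such a `w` is a neighbour of some `v ∈ T` undominated by `U v`, hence lies in `T ⊆ F`:
    -- contradiction.
    obtain ⟨w, hwF, hw⟩ := hG.exists_trace_mem (F := F) (by omega) (Finset.filter_subset _ _)
      (hM V U T F heq.ge hFT (fun v _ => (hU v).2.1) (fun v => (hU v).1) hrep)
    obtain ⟨-, v, hvT, hvw, hd⟩ := Finset.mem_filter.1 hw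
    have hvF := Finset.insert_subset_iff.1 (hFT v hvT)
    exact hwF (hFT w ((hU v).2.2 hvT w (mem_trace.1 hvw).2.symm
      (undominated_of_trace hvF.2 hwF hd)) (Finset.mem_insert_self _ _))

/-! ### Independence and uniformity of traces, by counting. -/

section Traces

variable {V : Type*} [Fintype V] [DecidableEq V]

open Classical in
/-- The number of graphs with prescribed traces on `F` of all vertices outside `F` does not depend
on these traces. -/
theorem card_trace_eq (F : Finset V) (τ : {w // w ∉ F} → Finset V) (hτ : ∀ w, τ w ⊆ F) :
    (Finset.univ.filter fun G : SimpleGraph V => (fun w : {w // w ∉ F} => trace G F w) = τ).card =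
    (Finset.univ.filter fun G : SimpleGraph V =>
      (fun w : {w // w ∉ F} => trace G F w) = fun _ => ∅).card := by
  -- `H` realises `τ` and has edges only between `F` and its complement; symmetric difference with
  -- `H` exchanges the traces `τ` and `∅`.
  let H : SimpleGraph V := SimpleGraph.fromRel fun a b => ∃ h : a ∉ F, b ∈ τ ⟨a, h⟩
  have hH : ∀ w : {w // w ∉ F}, ∀ v ∈ F, H.Adj w v ↔ v ∈ τ w := by
    intro w v hv
    simp only [H, SimpleGraph.fromRel_adj]
    refine ⟨?_, fun h => ⟨fun h' => w.2 (h' ▸ hv), Or.inl ⟨w.2, h⟩⟩⟩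
    rintro ⟨-, ⟨_, h⟩ | ⟨h, _⟩⟩
    · exact h
    · exact absurd hv h
  have hadj : ∀ G : SimpleGraph V, ∀ a b,
      (symmDiff G H).Adj a b ↔ (G.Adj a b ∧ ¬ H.Adj a b) ∨ (H.Adj a b ∧ ¬ G.Adj a b) := by
    intro G a b
    rw [symmDiff_def, SimpleGraph.sup_adj, SimpleGraph.sdiff_adj, SimpleGraph.sdiff_adj]
  refine Finset.card_nbij' (fun G => symmDiff G H) (fun G => symmDiff G H) ?_ ?_
    (fun G _ => symmDiff_symmDiff_cancel_right _ _)
    (fun G _ => symmDiff_symmDiff_cancel_right _ _)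
  · intro G hG
    simp only [Finset.coe_filter, Finset.mem_univ, true_and, Set.mem_ofPred_eq] at hG ⊢
    funext w
    ext v
    have h := congrArg (v ∈ ·) (congrFun hG w)
    simp only [mem_trace, eq_iff_iff] at h
    simp only [mem_trace, hadj, Finset.notMem_empty, iff_false]
    rintro ⟨hv, h'⟩
    have := hH w v hv
    tauto
  · intro G hG
    simp only [Finset.coe_filter, Finset.mem_univ, true_and, Set.mem_ofPred_eq] at hG ⊢
    funext w
    ext v
    have h := congrArg (v ∈ ·) (congrFun hG w)
    simp only [mem_trace, eq_iff_iff, Finset.notMem_empty, iff_false] at h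
    simp only [mem_trace, hadj]
    by_cases hv : v ∈ F
    · have := hH w v hv
      tauto
    · exact ⟨fun h => absurd h.1 hv, fun h => absurd (hτ w h) hv⟩

open Classical in
-- The unevaluated last factor is the common fibre size; comparison with `𝒬 = F.powerset` cancels it
-- in `prob_forall_trace_mem`.
theorem card_forall_trace_mem (F : Finset V) {𝒬 : Finset (Finset V)} (h𝒬 : 𝒬 ⊆ F.powerset) :
    Nat.card {G : SimpleGraph V // ∀ w, w ∉ F → trace G F w ∈ 𝒬} =
    𝒬.card ^ (Fintype.card V - F.card) * (Finset.univ.filter fun G : SimpleGraph V =>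
      (fun w : {w // w ∉ F} => trace G F w) = fun _ => ∅).card := by
  have hc : Fintype.card {w // w ∉ F} = Fintype.card V - F.card := by
    rw [Fintype.card_subtype_compl]; simp
  have hpi : (Fintype.piFinset fun _ : {w // w ∉ F} => 𝒬).card
      = 𝒬.card ^ (Fintype.card V - F.card) := by
    rw [Fintype.card_piFinset, Finset.prod_const, Finset.card_univ, hc]
  have hmaps : ∀ G ∈ Finset.univ.filter fun G : SimpleGraph V => ∀ w, w ∉ F → trace G F w ∈ 𝒬,
      (fun w : {w // w ∉ F} => trace G F w) ∈ Fintype.piFinset fun _ : {w // w ∉ F} => 𝒬 := by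
    intro G hG
    rw [Finset.mem_filter_univ] at hG
    exact Fintype.mem_piFinset.2 fun w => hG w w.2
  rw [Nat.card_eq_fintype_card, Fintype.card_subtype,
    Finset.card_eq_sum_card_fiberwise hmaps, ← hpi, ← smul_eq_mul]
  refine Finset.sum_eq_card_nsmul fun τ hτ => ?_
  rw [Fintype.mem_piFinset] at hτ
  rw [← card_trace_eq F τ fun w => Finset.mem_powerset.1 (h𝒬 (hτ w)), Finset.filter_filter]
  congr 1
  refine Finset.filter_congr fun G _ => and_iff_right_of_imp ?_
  rintro rfl w hw
  exact hτ ⟨w, hw⟩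

end Traces

/-! ### Probabilities in `G(n, 1/2)`. -/

section Probability

instance {V : Type*} [Finite V] : MeasurableSingletonClass (SimpleGraph V) := by
  refine ⟨fun G => ?_⟩
  rw [← SimpleGraph.measurableEmbedding_edgeSet.measurableSet_image, Set.image_singleton]
  exact MeasurableSet.singleton _

variable {n : ℕ}

theorem prob_nonneg (A : SimpleGraph (Fin n) → Prop) : 0 ≤ prob n A :=
  MeasureTheory.measureReal_nonneg

theorem prob_mono {A B : SimpleGraph (Fin n) → Prop} (h : ∀ G, A G → B G) : prob n A ≤ prob n B :=
  MeasureTheory.measureReal_mono h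

theorem prob_or_le (A B : SimpleGraph (Fin n) → Prop) :
    prob n (fun G => A G ∨ B G) ≤ prob n A + prob n B :=
  MeasureTheory.measureReal_union_le _ _

theorem prob_exists_le {ι : Type*} (s : Finset ι) (A : ι → SimpleGraph (Fin n) → Prop) :
    prob n (fun G => ∃ i ∈ s, A i G) ≤ ∑ i ∈ s, prob n (A i) := by
  refine le_trans (le_of_eq ?_) (MeasureTheory.measureReal_biUnion_finset_le s fun i => {G | A i G})
  unfold prob
  congr 1
  ext G
  simp

theorem sum_prob_le {ι : Type*} (s : Finset ι) (A : ι → SimpleGraph (Fin n) → Prop)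
    (B : SimpleGraph (Fin n) → Prop) (hA : ∀ i ∈ s, ∀ G, A i G → B G)
    (hd : ∀ i ∈ s, ∀ j ∈ s, i ≠ j → ∀ G, A i G → ¬ A j G) :
    ∑ i ∈ s, prob n (A i) ≤ prob n B := by
  unfold prob
  rw [← MeasureTheory.measureReal_biUnion_finset (f := fun i => {G | A i G})]
  · refine MeasureTheory.measureReal_mono fun G hG => ?_
    simp only [Set.mem_iUnion] at hG
    obtain ⟨i, hi, hG⟩ := hG
    exact hA i hi G hG
  · intro i hi j hj hij
    exact Set.disjoint_left.2 fun G h1 h2 => hd i hi j hj hij G h1 h2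
  · exact fun i _ => (Set.toFinite _).measurableSet

/-- Present and absent edges weigh the same, so every graph has mass `(1/2) ^ (n.choose 2)` and the
measure is uniform. -/
theorem prob_mul_card (A : SimpleGraph (Fin n) → Prop) :
    prob n A * Nat.card (SimpleGraph (Fin n)) = Nat.card {G // A G} := by
  classical
  have hsing : ∀ G : SimpleGraph (Fin n), (SimpleGraph.binomialRandom (Fin n) half).real {G} =
      (1 / 2 : ℝ) ^ (n.choose 2) := by
    intro G
    have hle : G.edgeSet.ncard ≤ n.choose 2 := by
      have := SimpleGraph.card_edgeFinset_le_card_choose_two (G := G)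
      rwa [Fintype.card_fin, ← Set.ncard_coe_finset, SimpleGraph.coe_edgeFinset] at this
    have h1 : ((unitInterval.toNNReal half : NNReal) : ℝ) = 1 / 2 := rfl
    have h2 : ((unitInterval.toNNReal (unitInterval.symm half) : NNReal) : ℝ) = 1 / 2 := by
      change 1 - (1 / 2 : ℝ) = 1 / 2
      norm_num
    rw [MeasureTheory.measureReal_def, SimpleGraph.binomialRandom_singleton]
    simp only [ENNReal.toReal_mul, ENNReal.toReal_pow, ENNReal.coe_toReal, h1, h2, Nat.card_fin]
    rw [← pow_add]
    congr 1
    omega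
  have hreal : ∀ s : Finset (SimpleGraph (Fin n)),
      (SimpleGraph.binomialRandom (Fin n) half).real s = s.card * (1 / 2 : ℝ) ^ (n.choose 2) := by
    intro s
    rw [← MeasureTheory.sum_measureReal_singleton, Finset.sum_congr rfl fun G _ => hsing G,
      Finset.sum_const, nsmul_eq_mul]
  have hA : prob n A = (Finset.univ.filter A).card * (1 / 2 : ℝ) ^ (n.choose 2) := by
    rw [← hreal, prob]
    simp
  have huniv := hreal Finset.univ
  rw [Finset.coe_univ, MeasureTheory.probReal_univ, Finset.card_univ] at huniv
  rw [Nat.card_eq_fintype_card, Nat.card_eq_fintype_card, Fintype.card_subtype, hA, mul_assoc,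
    mul_comm _ (Fintype.card _ : ℝ), ← huniv, mul_one]

theorem prob_forall_trace_mem (F : Finset (Fin n)) {𝒬 : Finset (Finset (Fin n))}
    (h𝒬 : 𝒬 ⊆ F.powerset) :
    prob n (fun G => ∀ w, w ∉ F → trace G F w ∈ 𝒬) =
      ((𝒬.card : ℝ) / 2 ^ F.card) ^ (n - F.card) := by
  classical
  have h1 := prob_mul_card (n := n) fun G => ∀ w, w ∉ F → trace G F w ∈ 𝒬
  have h2 := card_forall_trace_mem F h𝒬
  have h3 := card_forall_trace_mem F (Finset.Subset.refl F.powerset)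
  rw [Nat.card_congr (Equiv.subtypeUnivEquiv fun G w _ =>
    Finset.mem_powerset.2 (trace_subset G F w)), Finset.card_powerset, Fintype.card_fin] at h3
  rw [Fintype.card_fin] at h2
  rw [h2, h3] at h1
  have h4 : 0 < Nat.card (SimpleGraph (Fin n)) := Nat.card_pos
  rw [h3] at h4
  have h5 := Nat.pos_of_mul_pos_left h4
  push_cast at h1
  have h6 := Nat.cast_pos (α := ℝ).2 h5
  generalize (Finset.card _ : ℝ) = c at h1 h6
  rw [div_pow, eq_div_iff (by positivity)]
  refine mul_right_cancel₀ h6.ne' ?_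
  rw [mul_assoc]
  exact h1

/-- Domination by `U` means that `∅` is not a trace on `U`. -/
theorem prob_isDominatingSet (U : Finset (Fin n)) :
    prob n (fun G => IsDominatingSet G U) = (1 - (2 : ℝ) ^ (-(U.card : ℤ))) ^ (n - U.card) := by
  have h := prob_forall_trace_mem U (𝒬 := U.powerset.erase ∅) (Finset.erase_subset _ _)
  rw [Finset.card_erase_of_mem (Finset.empty_mem_powerset _), Finset.card_powerset,
    Nat.cast_sub Nat.one_le_two_pow, sub_div] at h
  push_cast at h
  rw [div_self (by positivity), one_div, ← zpow_natCast (2 : ℝ), ← zpow_neg] at h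
  rw [← h]
  congr 1
  funext G
  refine propext (forall_congr' fun w => imp_congr_right fun hw => ?_)
  rw [Finset.mem_erase, and_iff_left (Finset.mem_powerset.2 (trace_subset G U w)),
    ← Finset.nonempty_iff_ne_empty]
  constructor
  · rintro ⟨u, hu, h⟩
    exact ⟨u, mem_trace.2 ⟨hu, h.symm⟩⟩
  · rintro ⟨u, hu⟩
    exact ⟨u, (mem_trace.1 hu).1, (mem_trace.1 hu).2.symm⟩

/-- The proportion of traces present at a set that violates richness. -/
noncomputable def poorRatio (k : ℕ) : ℝ := 1 - 17 / 16 * (2 : ℝ) ^ (-(k : ℤ))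

/-- At `k = 0` the ratio is `-1/16`; that case is treated separately at the end. -/
theorem poorRatio_pos {k : ℕ} (hk : 1 ≤ k) : 0 < poorRatio k := by
  have : (2 : ℝ) ^ (-(k : ℤ)) ≤ 2 ^ (-1 : ℤ) := zpow_le_zpow_right₀ (by norm_num) (by omega)
  unfold poorRatio
  norm_num at this ⊢
  linarith

/-- Union bound over at most `(f + 1) * n ^ f` sets `F` and at most `2 ^ 2 ^ f` families `𝒬` that
contain all traces present on `F`. -/
theorem prob_not_isRich_le {k f : ℕ} (hk : 1 ≤ k) (hn : 1 ≤ n) :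
    prob n (fun G => ¬ IsRich G k f) ≤
      (f + 1) * 2 ^ 2 ^ f * (n : ℝ) ^ f * poorRatio k ^ (n - f) := by
  classical
  set q := poorRatio k with hq
  have hq0 : 0 < q := poorRatio_pos hk
  have hq1 : q ≤ 1 := by
    have : (0 : ℝ) < (2 : ℝ) ^ (-(k : ℤ)) := by positivity
    rw [hq, poorRatio]; linarith
  let 𝓕 : Finset (Finset (Fin n)) := Finset.univ.filter fun F => F.card ≤ f
  let 𝓠 : Finset (Fin n) → Finset (Finset (Finset (Fin n))) := fun F =>
    F.powerset.powerset.filter fun 𝒬 => (𝒬.card : ℝ) / 2 ^ F.card ≤ q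
  have hsub : ∀ G : SimpleGraph (Fin n), ¬ IsRich G k f →
      ∃ F ∈ 𝓕, ∃ 𝒬 ∈ 𝓠 F, ∀ w, w ∉ F → trace G F w ∈ 𝒬 := by
    intro G hG
    unfold IsRich at hG
    push Not at hG
    obtain ⟨F, hF, hm⟩ := hG
    refine ⟨F, by simpa [𝓕] using hF, F.powerset \ missing G F, ?_, ?_⟩
    · refine Finset.mem_filter.2 ⟨Finset.mem_powerset.2 Finset.sdiff_subset, ?_⟩
      have hmF : missing G F ⊆ F.powerset := fun S hS =>
        Finset.mem_powerset.2 (mem_missing.1 hS).1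
      have hc := Finset.card_sdiff_add_card_eq_card hmF
      rw [Finset.card_powerset] at hc
      have hc' : ((F.powerset \ missing G F).card : ℝ) + (missing G F).card = 2 ^ F.card := by
        exact_mod_cast hc
      have hm' : (17 : ℝ) * 2 ^ F.card ≤ 16 * 2 ^ k * (missing G F).card := by exact_mod_cast hm
      rw [div_le_iff₀ (by positivity), hq, poorRatio, sub_mul, zpow_neg, zpow_natCast, one_mul]
      have h2 : (0 : ℝ) < 2 ^ k := by positivity
      have : 17 / 16 * ((2 : ℝ) ^ k)⁻¹ * 2 ^ F.card ≤ (missing G F).card := by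
        rw [← div_eq_mul_inv, div_mul_eq_mul_div, div_le_iff₀ h2]
        linarith
      linarith
    · intro w hw
      refine Finset.mem_sdiff.2 ⟨Finset.mem_powerset.2 (trace_subset G F w), fun h => ?_⟩
      exact (mem_missing.1 h).2 w hw rfl
  have hF : ∀ F ∈ 𝓕, prob n (fun G => ∃ 𝒬 ∈ 𝓠 F, ∀ w, w ∉ F → trace G F w ∈ 𝒬) ≤
      2 ^ 2 ^ f * q ^ (n - f) := by
    intro F hF
    have hFf : F.card ≤ f := by simpa [𝓕] using hF
    refine (prob_exists_le _ _).trans ?_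
    have hb : ∀ 𝒬 ∈ 𝓠 F, prob n (fun G => ∀ w, w ∉ F → trace G F w ∈ 𝒬) ≤ q ^ (n - f) := by
      intro 𝒬 h𝒬
      obtain ⟨h1, h2⟩ := Finset.mem_filter.1 h𝒬
      rw [prob_forall_trace_mem F (Finset.mem_powerset.1 h1)]
      calc _ ≤ q ^ (n - F.card) := pow_le_pow_left₀ (by positivity) h2 _
        _ ≤ q ^ (n - f) := pow_le_pow_of_le_one hq0.le hq1 (by omega)
    refine (Finset.sum_le_card_nsmul _ _ _ hb).trans ?_
    rw [nsmul_eq_mul]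
    refine mul_le_mul_of_nonneg_right ?_ (by positivity)
    have : (𝓠 F).card ≤ 2 ^ 2 ^ f := by
      refine (Finset.card_filter_le _ _).trans ?_
      rw [Finset.card_powerset, Finset.card_powerset]
      exact Nat.pow_le_pow_right (by norm_num) (Nat.pow_le_pow_right (by norm_num) hFf)
    exact_mod_cast this
  have h𝓕 : (𝓕.card : ℝ) ≤ (f + 1) * (n : ℝ) ^ f := by
    have h1 : 𝓕 ⊆ (Finset.range (f + 1)).biUnion fun i => Finset.univ.powersetCard i := by
      intro F hF
      have hFf : F.card ≤ f := by simpa [𝓕] using hF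
      exact Finset.mem_biUnion.2 ⟨F.card, Finset.mem_range.2 (by omega), by simp⟩
    have h2 := (Finset.card_le_card h1).trans
      (Finset.card_biUnion_le_card_mul _ _ (n ^ f) fun i hi => by
        rw [Finset.card_powersetCard, Finset.card_univ, Fintype.card_fin]
        exact (Nat.choose_le_pow n i).trans
          (Nat.pow_le_pow_right hn (by have := Finset.mem_range.1 hi; omega)))
    rw [Finset.card_range] at h2
    exact_mod_cast h2
  calc _ ≤ prob n (fun G => ∃ F ∈ 𝓕, ∃ 𝒬 ∈ 𝓠 F, ∀ w, w ∉ F → trace G F w ∈ 𝒬) := prob_mono hsub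
    _ ≤ ∑ F ∈ 𝓕, _ := prob_exists_le _ _
    _ ≤ 𝓕.card • (2 ^ 2 ^ f * q ^ (n - f)) := Finset.sum_le_card_nsmul _ _ _ hF
    _ ≤ (f + 1) * (n : ℝ) ^ f * (2 ^ 2 ^ f * q ^ (n - f)) := by
      rw [nsmul_eq_mul]
      exact mul_le_mul_of_nonneg_right h𝓕 (by positivity)
    _ = _ := by ring

end Probability

/-! ### Comparison with the main term. -/

section Asymptotics

/-- The probability `1 - 2 ^ (-k)` that a vertex is dominated by a fixed set of `k` vertices. -/
noncomputable def dominationRatio (k : ℕ) : ℝ := 1 - (2 : ℝ) ^ (-(k : ℤ))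

theorem poorRatio_lt_dominationRatio (k : ℕ) : poorRatio k < dominationRatio k := by
  have : (0 : ℝ) < (2 : ℝ) ^ (-(k : ℤ)) := by positivity
  unfold poorRatio dominationRatio
  linarith

theorem dominationRatio_pos {k : ℕ} (hk : 1 ≤ k) : 0 < dominationRatio k :=
  (poorRatio_pos hk).trans (poorRatio_lt_dominationRatio k)

theorem mainTerm_eq {k n : ℕ} (hk : 1 ≤ k) (hn : k ≤ n) :
    mainTerm k n = n.choose k * dominationRatio k ^ (n - k) := by
  have h := (dominationRatio_pos hk).ne'
  rw [mainTerm, ← dominationRatio, zpow_neg, zpow_natCast, pow_sub₀ _ h hn]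
  ring

theorem prob_hasDominatingSet_le {k n : ℕ} (hk : 1 ≤ k) (hn : k ≤ n) :
    prob n (fun G => HasDominatingSet G k) ≤ mainTerm k n := by
  calc _ ≤ prob n (fun G => ∃ U ∈ Finset.univ.powersetCard k, IsDominatingSet G U) :=
        prob_mono fun G ⟨S, hS, h⟩ => ⟨S, by simpa using hS, h⟩
    _ ≤ ∑ U ∈ Finset.univ.powersetCard k, prob n (fun G => IsDominatingSet G U) :=
        prob_exists_le _ _
    _ = ∑ U ∈ (Finset.univ : Finset (Fin n)).powersetCard k, dominationRatio k ^ (n - k) :=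
        Finset.sum_congr rfl fun U hU => by
          rw [prob_isDominatingSet, (Finset.mem_powersetCard.1 hU).2, dominationRatio]
    _ = mainTerm k n := by
        rw [mainTerm_eq hk hn, Finset.sum_const, Finset.card_powersetCard, Finset.card_univ,
          Fintype.card_fin, nsmul_eq_mul]

/-- Among rich graphs the events that `U` dominates are disjoint for different `U`, so their
probabilities add; each `U` loses at most the probability of non-richness. No second moment is
needed. -/
theorem mainTerm_le_prob_hasDominatingSet {k f n : ℕ} (hk : 1 ≤ k) (hf : 2 * k + 6 ≤ f)
    (hn : k + 4 ≤ n) : mainTerm k n ≤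
      prob n (fun G => HasDominatingSet G k) + n.choose k * prob n (fun G => ¬ IsRich G k f) := by
  have hU : ∀ U ∈ (Finset.univ : Finset (Fin n)).powersetCard k, dominationRatio k ^ (n - k) ≤
      prob n (fun G => IsDominatingSet G U ∧ IsRich G k f) + prob n (fun G => ¬ IsRich G k f) := by
    intro U hU
    have h := prob_isDominatingSet U
    rw [(Finset.mem_powersetCard.1 hU).2, ← dominationRatio] at h
    rw [← h]
    refine (prob_mono fun G hG => ?_).trans (prob_or_le _ _)
    by_cases hr : IsRich G k f
    · exact Or.inl ⟨hG, hr⟩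
    · exact Or.inr hr
  have hsum := Finset.sum_le_sum hU
  rw [Finset.sum_add_distrib, Finset.sum_const, Finset.sum_const, Finset.card_powersetCard,
    Finset.card_univ, Fintype.card_fin, nsmul_eq_mul, nsmul_eq_mul,
    ← mainTerm_eq hk (by omega)] at hsum
  refine hsum.trans (add_le_add_left (sum_prob_le _ _ _ ?_ ?_) _)
  · exact fun U hU G hG => ⟨U, (Finset.mem_powersetCard.1 hU).2, hG.1⟩
  · intro U hU U' hU' hne G hG hG'
    exact hne (hG.2.dominatingSet_unique (M := 0) (by omega) (by simpa using hn)
      (Finset.mem_powersetCard.1 hU').2 (Finset.mem_powersetCard.1 hU).2 hG'.1 hG.1)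

theorem prob_isCopWin_le {k f n : ℕ} (hn : k + 4 ≤ n)
    (hf : ∀ (V : Type) [Fintype V] (G : SimpleGraph V), k + 4 ≤ Fintype.card V → IsRich G k f →
      ¬ HasDominatingSet G k → ¬ CopsCanWin G k) :
    prob n (fun G => IsCopWin G k) ≤
      prob n (fun G => HasDominatingSet G k) + prob n (fun G => ¬ IsRich G k f) := by
  have : Nonempty (Fin n) := ⟨⟨0, by omega⟩⟩
  refine (prob_mono fun G hG => ?_).trans (prob_or_le _ _)
  rw [isCopWin_iff_copsCanWin] at hG
  by_contra h
  push Not at h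
  exact hf _ G (by simpa using hn) h.2 h.1 hG

theorem prob_hasDominatingSet_le_prob_isCopWin {k n : ℕ} (hn : 1 ≤ n) :
    prob n (fun G => HasDominatingSet G k) ≤ prob n (fun G => IsCopWin G k) := by
  have : Nonempty (Fin n) := ⟨⟨0, by omega⟩⟩
  exact prob_mono fun G hG => (isCopWin_iff_copsCanWin G k).2 hG.copsCanWin

theorem mainTerm_isTheta {k : ℕ} (hk : 1 ≤ k) :
    (fun n : ℕ => mainTerm k n) =Θ[atTop] fun n : ℕ => (n : ℝ) ^ k * dominationRatio k ^ n := by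
  have h1 : (fun n : ℕ => (n.choose k : ℝ)) =Θ[atTop] fun n : ℕ => (n : ℝ) ^ k :=
    isTheta_choose k
  have h2 := isTheta_refl (fun n : ℕ => dominationRatio k ^ n) atTop
  have h3 := (isTheta_const_mul_left (zpow_ne_zero (-(k : ℤ)) (dominationRatio_pos hk).ne')).2
    (h1.mul h2)
  refine IsTheta.trans (EventuallyEq.isTheta (Eventually.of_forall fun n => ?_)) h3
  simp only [mainTerm, dominationRatio]
  ring

/-- Even after multiplication with `n ^ k`, the probability of violating richness is negligible. -/
theorem pow_mul_prob_not_isRich_isLittleO {k : ℕ} (hk : 1 ≤ k) (f : ℕ) :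
    (fun n : ℕ => (n : ℝ) ^ k * prob n (fun G => ¬ IsRich G k f)) =o[atTop]
      fun n : ℕ => mainTerm k n := by
  have hq := poorRatio_pos hk
  have h1 := isLittleO_pow_const_mul_const_pow_const_pow_of_norm_lt (R := ℝ) f
    (r₁ := poorRatio k) (r₂ := dominationRatio k)
    (by rw [Real.norm_of_nonneg hq.le]; exact poorRatio_lt_dominationRatio k)
  have h2 : (fun n : ℕ => (n : ℝ) ^ k * ((n : ℝ) ^ f * poorRatio k ^ n)) =o[atTop]
      fun n : ℕ => (n : ℝ) ^ k * dominationRatio k ^ n :=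
    (isBigO_refl _ _).mul_isLittleO h1
  refine IsBigO.trans_isLittleO ?_ (h2.trans_isTheta (mainTerm_isTheta hk).symm)
  refine IsBigO.of_bound ((f + 1) * 2 ^ 2 ^ f * (poorRatio k ^ f)⁻¹) ?_
  filter_upwards [eventually_ge_atTop (f + 1)] with n hn
  rw [Real.norm_of_nonneg (mul_nonneg (by positivity) (prob_nonneg _)),
    Real.norm_of_nonneg (by positivity)]
  calc _ ≤ (n : ℝ) ^ k * ((f + 1) * 2 ^ 2 ^ f * (n : ℝ) ^ f * poorRatio k ^ (n - f)) :=
        mul_le_mul_of_nonneg_left (prob_not_isRich_le hk (by omega)) (by positivity)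
    _ = _ := by
        rw [pow_sub₀ _ hq.ne' (by omega)]
        ring

theorem isEquivalent_mainTerm_of_abs_sub_le {k f : ℕ} (hk : 1 ≤ k) (p : ℕ → ℝ)
    (hp : ∀ᶠ n in atTop, |p n - mainTerm k n| ≤
      (n : ℝ) ^ k * prob n (fun G => ¬ IsRich G k f)) :
    p ~[atTop] fun n : ℕ => mainTerm k n := by
  refine IsBigO.trans_isLittleO (IsBigO.of_bound 1 ?_) (pow_mul_prob_not_isRich_isLittleO hk f)
  filter_upwards [hp] with n hn
  rw [one_mul]
  exact hn.trans (le_abs_self _)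

/-- Each error is at most `1` or `n.choose k` times the probability of non-richness, and `n ^ k`
dominates both factors. -/
theorem isEquivalent_prob {k : ℕ} (hk : 1 ≤ k) :
    ((fun n : ℕ => prob n (fun G => IsCopWin G k)) ~[atTop] fun n : ℕ => mainTerm k n) ∧
    ((fun n : ℕ => prob n (fun G => HasDominatingSet G k)) ~[atTop]
      fun n : ℕ => mainTerm k n) := by
  obtain ⟨f, hf, hwin⟩ := exists_forall_isRich_not_copsCanWin k
  constructor <;> refine isEquivalent_mainTerm_of_abs_sub_le (f := f) hk _ ?_ <;>
    filter_upwards [eventually_ge_atTop (k + 4)] with n hn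
  all_goals
    have h1 := prob_hasDominatingSet_le (n := n) hk (by omega)
    have h2 := mainTerm_le_prob_hasDominatingSet hk hf hn
    have h3 := prob_isCopWin_le hn hwin
    have h4 := prob_hasDominatingSet_le_prob_isCopWin (k := k) (n := n) (by omega)
    have h5 := prob_nonneg (n := n) fun G => ¬ IsRich G k f
    have h6 : (n.choose k : ℝ) ≤ (n : ℝ) ^ k := by exact_mod_cast Nat.choose_le_pow n k
    have h7 : (1 : ℝ) ≤ (n : ℝ) ^ k := one_le_pow₀ (by exact_mod_cast (show 1 ≤ n by omega))
    have h8 := mul_le_mul_of_nonneg_right h6 h5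
    have h9 := mul_le_mul_of_nonneg_right h7 h5
    rw [abs_le]
    constructor <;> linarith

theorem prob_eq_zero {n : ℕ} {A : SimpleGraph (Fin n) → Prop} (h : ∀ G, ¬ A G) :
    prob n A = 0 := by
  simp [prob, h]

end Asymptotics

end CopsRobbers

theorem theorem2 (k : ℕ) :
    ((fun n : ℕ => CopsRobbers.prob n (fun G => CopsRobbers.IsCopWin G k))
        ~[atTop] fun n : ℕ => CopsRobbers.mainTerm k n) ∧
    ((fun n : ℕ => CopsRobbers.prob n (fun G => CopsRobbers.IsCopWin G k))
        =Θ[atTop] fun n : ℕ => (n : ℝ) ^ k * (1 - (2 : ℝ) ^ (-(k : ℤ))) ^ n) ∧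
    ((fun n : ℕ => CopsRobbers.prob n (fun G => CopsRobbers.HasDominatingSet G k))
        ~[atTop] fun n : ℕ => CopsRobbers.mainTerm k n) := by
  rcases Nat.eq_zero_or_pos k with rfl | hk
  -- For `k = 0` and `n ≥ 1` everything vanishes: zero cops never win, and `1 - 2 ^ 0 = 0`.
  · have hwin : ∀ᶠ n : ℕ in atTop,
        CopsRobbers.prob n (fun G => CopsRobbers.IsCopWin G 0) = 0 := by
      filter_upwards [eventually_ge_atTop 1] with n hn
      have : Nonempty (Fin n) := ⟨⟨0, hn⟩⟩
      exact CopsRobbers.prob_eq_zero fun G hG =>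
        CopsRobbers.not_copsCanWin_zero G ((CopsRobbers.isCopWin_iff_copsCanWin G 0).1 hG)
    have hdom : ∀ᶠ n : ℕ in atTop,
        CopsRobbers.prob n (fun G => CopsRobbers.HasDominatingSet G 0) = 0 := by
      filter_upwards [eventually_ge_atTop 1] with n hn
      have : Nonempty (Fin n) := ⟨⟨0, hn⟩⟩
      exact CopsRobbers.prob_eq_zero fun G hG =>
        CopsRobbers.not_copsCanWin_zero G hG.copsCanWin
    have hmain : ∀ᶠ n : ℕ in atTop, CopsRobbers.mainTerm 0 n = 0 := by
      filter_upwards [eventually_ge_atTop 1] with n hn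
      simp [CopsRobbers.mainTerm, show n ≠ 0 by omega]
    refine ⟨EventuallyEq.isEquivalent ?_, EventuallyEq.isTheta ?_, EventuallyEq.isEquivalent ?_⟩
    · filter_upwards [hwin, hmain] with n h1 h2 using h1.trans h2.symm
    · filter_upwards [hwin, eventually_ge_atTop 1] with n h1 hn
      simp [h1, show n ≠ 0 by omega]
    · filter_upwards [hdom, hmain] with n h1 h2 using h1.trans h2.symm
  · obtain ⟨h1, h2⟩ := CopsRobbers.isEquivalent_prob hk
    exact ⟨h1, h1.isTheta.trans (CopsRobbers.mainTerm_isTheta hk), h2⟩
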